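/- Let $\mathcal X,\mathcal Y$ be finite sets, $P$ a probability distribution on $\mathcal X$, $\delta:\mathcal X\times\mathcal Y\to\mathbb R_{\ge 0}$ a distortion measure, and $\delta^n(x^n,y^n)=\sum_{k=1}^n\delta(x_k,y_k)$ its extension to words. An $n$-block code is a pair of stochastic maps $E:\mathcal X^n\to\mathcal C$, $D:\mathcal C\to\mathcal Y^n$ with a finite set $\mathcal C$; its rate is $\frac1n\log_2|\mathcal C|$ and its distortion is $d(E,D)=\sum_{x^n}P^n(x^n)\,\mathbb E\,\delta^n(x^n,D(E(x^n)))$, with $P^n(x^n)=\prod_{k=1}^n P(x_k)$ and the expectation over the randomness of $E$ and $D$. For $R,d\ge 0$ the pair $(R,d)$ is achievable if there are $n$-block codes $(E_n,D_n)$, $n=1,2,\dots$, whose rates tend to $R$ and for which $\limsup_{n\to\infty}\frac1n d(E_n,D_n)\le d$. The rate-distortion function $R(d)$ is the infimum of all $R$ such that $(R,d)$ is achievable ($+\infty$ if there are none). For a channel $W$ from $\mathcal X$ to $\mathcal Y$, i.e. a family of probability distributions $W_x$ on $\mathcal Y$ ($x\in\mathcal X$), let $PW=\sum_xP(x)W_x$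 and $I(P;W)=H(PW)-\sum_xP(x)H(W_x)$, where $H(Q)=-\sum_a Q(a)\log_2Q(a)$ with $0\log_2 0=0$, and let $\mathbb E\,\delta(X,Y)=\sum_{x,y}P(x)W_x(y)\delta(x,y)$. Theorem (Shannon's rate-distortion theorem). For every $d\ge 0$, $$R(d)=\inf\{I(P;W):\ W\text{ a channel with }\mathbb E\,\delta(X,Y)\le d\},$$ where both sides are $+\infty$ if there is no such channel. If there is such a channel, then both infima are attained: some such channel $W$ minimizes $I(P;W)$, and $R(d)=I(P;W)$ is the least $R$ for which $(R,d)$ is achievable. Moreover, $(R,d)$ is achievable if and only if it is achievable with deterministic codes. -/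

import Mathlib

open Filter Topology

namespace RateDistortion

noncomputable section

/-- Shannon entropy (in bits) of a probability vector on a finite set. -/
def entropy {A : Type*} [Fintype A] (Q : A → ℝ) : ℝ :=
  -∑ a, Q a * Real.logb 2 (Q a)

/-- A stochastic map (channel) from `A` to `B`: every `W a` is a probability vector on `B`. -/
def IsChannel {A B : Type*} [Fintype B] (W : A → B → ℝ) : Prop :=
  ∀ a, W a ∈ stdSimplex ℝ B

/-- The output distribution `PW = ∑ₓ P(x) Wₓ`. -/
def outputDist {X Y : Type*} [Fintype X] (P : X → ℝ) (W : X → Y → ℝ) : Y → ℝ :=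
  fun y => ∑ x, P x * W x y

/-- The mutual information `I(P;W) = H(PW) - ∑ₓ P(x) H(Wₓ)`. -/
def mutualInfo {X Y : Type*} [Fintype X] [Fintype Y] (P : X → ℝ) (W : X → Y → ℝ) : ℝ :=
  entropy (outputDist P W) - ∑ x, P x * entropy (W x)

/-- The expected single-letter distortion `∑ P(x) Wₓ(y) δ(x,y)`. -/
def expDistortion {X Y : Type*} [Fintype X] [Fintype Y] (P : X → ℝ) (δ : X → Y → ℝ)
    (W : X → Y → ℝ) : ℝ :=
  ∑ x, ∑ y, P x * W x y * δ x y

/-- The channels from `X` to `Y` whose expected distortion is at most `D`. -/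
def feasibleChannels {X Y : Type*} [Fintype X] [Fintype Y] (P : X → ℝ) (δ : X → Y → ℝ)
    (D : ℝ) : Set (X → Y → ℝ) :=
  {W | IsChannel W ∧ expDistortion P δ W ≤ D}

/-- The memoryless extension `Pⁿ(xⁿ) = ∏ₖ P(xₖ)`. -/
def powDist {X : Type*} (P : X → ℝ) {n : ℕ} (x : Fin n → X) : ℝ :=
  ∏ k, P (x k)

/-- The distortion of words, `δⁿ(xⁿ,yⁿ) = ∑ₖ δ(xₖ,yₖ)`. -/
def wordDistortion {X Y : Type*} (δ : X → Y → ℝ) {n : ℕ} (x : Fin n → X) (y : Fin n → Y) : ℝ :=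
  ∑ k, δ (x k) (y k)

/-- An `n`-block code: stochastic maps `E : Xⁿ → C` and `D : C → Yⁿ`, where the finite set `C`
is taken to be `Fin size`. -/
structure BlockCode (X Y : Type*) [Fintype Y] (n : ℕ) where
  size : ℕ
  enc : (Fin n → X) → Fin size → ℝ
  dec : Fin size → (Fin n → Y) → ℝ
  enc_isChannel : IsChannel enc
  dec_isChannel : IsChannel dec

/-- Both maps of the code take point masses as values. -/
def BlockCode.IsDeterministic {X Y : Type*} [Fintype Y] {n : ℕ} (K : BlockCode X Y n) : Prop :=
  (∀ x, ∃ c, K.enc x c = 1) ∧ ∀ c, ∃ y, K.dec c y = 1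

/-- The code rate `(1/n) log₂ |C|`. -/
def BlockCode.rate {X Y : Type*} [Fintype Y] {n : ℕ} (K : BlockCode X Y n) : ℝ :=
  Real.logb 2 K.size / n

/-- The average distortion `∑ Pⁿ(xⁿ) δⁿ(xⁿ, D(E(xⁿ)))` between source and output word, where
`δⁿ(xⁿ, ·)` is averaged over the random output of the code. -/
def BlockCode.distortion {X Y : Type*} [Fintype X] [Fintype Y] {n : ℕ} (P : X → ℝ)
    (δ : X → Y → ℝ) (K : BlockCode X Y n) : ℝ :=
  ∑ x : Fin n → X, powDist P x *
    ∑ c, K.enc x c * ∑ y : Fin n → Y, K.dec c y * wordDistortion δ x y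

/-- There are codes of all block lengths, each satisfying the side condition `S`, whose rate tends
to `R` and whose distortion rate is asymptotically bounded by `D`. -/
def AchievableBy {X Y : Type*} [Fintype X] [Fintype Y]
    (S : ∀ {n : ℕ}, BlockCode X Y n → Prop) (P : X → ℝ) (δ : X → Y → ℝ) (R D : ℝ) : Prop :=
  0 ≤ R ∧ 0 ≤ D ∧ ∃ K : ∀ n : ℕ, BlockCode X Y n,
    (∀ n, S (K n)) ∧
    Tendsto (fun n => (K n).rate) atTop (𝓝 R) ∧
    ∀ ε > 0, ∀ᶠ n : ℕ in atTop, (K n).distortion P δ ≤ n * (D + ε)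

/-- `(R, D)` is achievable. -/
def Achievable {X Y : Type*} [Fintype X] [Fintype Y] (P : X → ℝ) (δ : X → Y → ℝ)
    (R D : ℝ) : Prop :=
  AchievableBy (fun _ => True) P δ R D

/-- `(R, D)` is achievable with deterministic codes. -/
def AchievableDet {X Y : Type*} [Fintype X] [Fintype Y] (P : X → ℝ) (δ : X → Y → ℝ)
    (R D : ℝ) : Prop :=
  AchievableBy BlockCode.IsDeterministic P δ R D

/-- The rate-distortion function: the infimum of the `R` for which `(R, D)` is achievable, with
value `⊤` if there is none. That it is a minimum is part of the theorem. -/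
def rateDistortion {X Y : Type*} [Fintype X] [Fintype Y] (P : X → ℝ) (δ : X → Y → ℝ)
    (D : ℝ) : EReal :=
  sInf ((fun R : ℝ => (R : EReal)) '' {R | Achievable P δ R D})

end

end RateDistortion

/-!
# Shannon's rate-distortion theorem

The set of feasible channels is compact and `I(P;·)` is continuous on it, so a minimizer exists as
soon as there is a feasible channel. The theorem then reduces to two statements: every feasible `W`
makes `(I(P;W), D)` achievable, and every achievable `(R, D)` admits a feasible `W` with
`I(P;W) ≤ R`.

*Converse* (`exists_singleLetter_channel`, `Achievable.exists_feasible`). Let a code with `M` indices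
induce the channel `V` between words, and let `W` be the average of the single-letter marginals
of `V`, so that `W` has the distortion per letter of the code. Instead of chaining mutual
informations, one applies Gibbs' inequality `E[log g] ≤ log E[g]` to
`g(x,y) = ∏ₖ W(yₖ|xₖ) / PW(yₖ)`. The left side is `n I(P;W)`. On the right, `V(y|x)` is at most the
sum over the indices `c` of the decoding probabilities `D(y|c)`, and for fixed `y` the average of
`g(·,y)` over the source is at most `1`; hence `E[g] ≤ M`. A limit point of these channels along
the block lengths is feasible and has `I(P;W) ≤ R`.

*Direct part* (`exists_covering`, `tendsto_tailProb`, `eventually_exists_code`). Codewords are drawn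
independently from the `n`-fold power of `PW`. Call a pair of words good if its information density
is at most `n (I(P;W) + ε)` and its distortion at most `n (D + ε)`. A change of measure shows that a
random codeword forms a good pair with a source word with probability at least
`2 ^ (-n (I(P;W) + ε))` times the corresponding probability for the output of the memoryless
channel `W`. By the weak law of large numbers the latter is close to `1` for most source words, so
`2 ^ (n (I(P;W) + 2 ε))` codewords cover the source up to vanishing probability. Choosing
near-optimal codes at every block length then gives rates converging to `I(P;W)` itself.

*Deterministic codes* (`exists_deterministic_distortion_le`). Replacing averages by minima, first in
the decoder and then in the encoder, derandomizes a code without changing its size.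
-/

namespace RateDistortion

/-! ### Probability vectors and product weights -/

lemma exists_le_weighted_sum {A : Type*} [Fintype A] {w : A → ℝ} (hw : w ∈ stdSimplex ℝ A)
    (f : A → ℝ) : ∃ a, f a ≤ ∑ a, w a * f a := by
  by_contra! h
  have hne : ∃ a, w a ≠ 0 := by
    by_contra! h0
    have := hw.2
    simp [h0] at this
  obtain ⟨a, ha⟩ := hne
  have h1 : ∑ b, w b * (∑ a, w a * f a) < ∑ b, w b * f b :=
    Finset.sum_lt_sum (fun b _ => mul_le_mul_of_nonneg_left (h b).le (hw.1 b))
      ⟨a, Finset.mem_univ a, mul_lt_mul_of_pos_left (h a) ((hw.1 a).lt_of_ne' ha)⟩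
  rw [← Finset.sum_mul, hw.2, one_mul] at h1
  exact lt_irrefl _ h1

lemma nonempty_of_mem_stdSimplex {A : Type*} [Fintype A] {w : A → ℝ}
    (hw : w ∈ stdSimplex ℝ A) : Nonempty A :=
  (exists_le_weighted_sum hw 0).nonempty

lemma powDist_mem_stdSimplex {X : Type*} [Fintype X] {P : X → ℝ} (hP : P ∈ stdSimplex ℝ X)
    (n : ℕ) : (powDist P : (Fin n → X) → ℝ) ∈ stdSimplex ℝ (Fin n → X) := by
  refine ⟨fun x => Finset.prod_nonneg fun k _ => hP.1 _, ?_⟩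
  simp only [powDist]
  rw [← Fintype.sum_pow, hP.2, one_pow]

lemma sum_powDist_eval {X : Type*} [Fintype X] [DecidableEq X] {P : X → ℝ} (hP : P ∈ stdSimplex ℝ X)
    {n : ℕ} (k : Fin n) (a : X) :
    ∑ x : Fin n → X, (if x k = a then powDist P x else 0) = P a := by
  have h : ∀ x : Fin n → X, (if x k = a then powDist P x else 0) =
      ∏ j, (if j = k then (if x j = a then P (x j) else 0) else P (x j)) := by
    intro x
    split_ifs with hx
    · refine Finset.prod_congr rfl fun j _ => ?_
      by_cases hj : j = k
      · subst hj; simp [hx]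
      · simp [hj]
    · exact (Finset.prod_eq_zero (Finset.mem_univ k) (by simp [hx])).symm
  simp only [h]
  rw [← Fintype.prod_sum
    (f := fun j b => if j = k then (if b = a then P b else 0) else P b)]
  rw [Finset.prod_eq_single k]
  · simp
  · intro j _ hj; simp [hj, hP.2]
  · simp

/-- Expectation of `f ∘ φ` computed from the push-forward of the weight `r` under `φ`. -/
lemma sum_pushforward_mul {Ω A : Type*} [Fintype Ω] [Fintype A] [DecidableEq A] (r : Ω → ℝ)
    (φ : Ω → A) (f : A → ℝ) :
    ∑ a, (∑ ω, if φ ω = a then r ω else 0) * f a = ∑ ω, r ω * f (φ ω) := by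
  simp only [Finset.sum_mul]
  rw [Finset.sum_comm]
  refine Finset.sum_congr rfl fun ω _ => ?_
  simp [ite_mul]

/-- **Gibbs' inequality** in the form needed here: `E[log g] ≤ log E[g]`, with an upper bound `M`
in place of `E[g]`. Positivity of `g` is only required on the support of `p`, so that the value of
`logb` at `0` plays no role. -/
lemma sum_mul_logb_le {A : Type*} [Fintype A] {p : A → ℝ} (hp : p ∈ stdSimplex ℝ A) {g : A → ℝ}
    (hg : ∀ a, p a ≠ 0 → 0 < g a) {M : ℝ} (hM : ∑ a, p a * g a ≤ M) :
    ∑ a, p a * Real.logb 2 (g a) ≤ Real.logb 2 M := by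
  have hMpos : 0 < M := by
    obtain ⟨a, ha⟩ : ∃ a, p a ≠ 0 := by
      by_contra! h0
      have := hp.2
      simp [h0] at this
    refine lt_of_lt_of_le (Finset.sum_pos' (fun b _ => ?_) ⟨a, Finset.mem_univ a, ?_⟩) hM
    · by_cases hb : p b = 0
      · simp [hb]
      · exact mul_nonneg (hp.1 b) (hg b hb).le
    · exact mul_pos ((hp.1 a).lt_of_ne' ha) (hg a ha)
  have key : ∑ a, p a * Real.log (g a) ≤ Real.log M := by
    have h1 : ∀ a, p a * Real.log (g a) ≤ p a * g a / M + p a * (Real.log M - 1) := by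
      intro a
      by_cases ha : p a = 0
      · simp [ha]
      · have h2 := Real.log_le_sub_one_of_pos (div_pos (hg a ha) hMpos)
        rw [Real.log_div (hg a ha).ne' hMpos.ne'] at h2
        have h3 := mul_le_mul_of_nonneg_left h2 (hp.1 a)
        have h4 : p a * (g a / M - 1) = p a * g a / M - p a := by ring
        linarith
    calc ∑ a, p a * Real.log (g a)
        ≤ ∑ a, (p a * g a / M + p a * (Real.log M - 1)) := Finset.sum_le_sum fun a _ => h1 a
      _ = (∑ a, p a * g a) / M + (Real.log M - 1) := by
          rw [Finset.sum_add_distrib, ← Finset.sum_div, ← Finset.sum_mul, hp.2, one_mul]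
      _ ≤ 1 + (Real.log M - 1) := by
          gcongr
          exact (div_le_one hMpos).2 hM
      _ = Real.log M := by ring
  simp only [Real.logb, ← mul_div_assoc]
  rw [← Finset.sum_div]
  exact div_le_div_of_nonneg_right key (Real.log_nonneg (by norm_num))

/-! ### Mutual information -/

/-- The mutual information as the expectation of the information density
`log (W x y / PW y)`. -/
lemma mutualInfo_eq_sum {X Y : Type*} [Fintype X] [Fintype Y] (P : X → ℝ) (W : X → Y → ℝ) :
    mutualInfo P W = ∑ x, ∑ y, P x * W x y *
      (Real.logb 2 (W x y) - Real.logb 2 (outputDist P W y)) := by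
  simp only [mul_sub, Finset.sum_sub_distrib, mutualInfo, entropy]
  have h : ∑ x, ∑ y, P x * W x y * Real.logb 2 (outputDist P W y) =
      ∑ y, outputDist P W y * Real.logb 2 (outputDist P W y) := by
    rw [Finset.sum_comm]
    refine Finset.sum_congr rfl fun y _ => ?_
    rw [← Finset.sum_mul, outputDist]
  rw [h]
  simp only [mul_neg, Finset.sum_neg_distrib, Finset.mul_sum, mul_assoc]
  ring

lemma outputDist_mem_stdSimplex {X Y : Type*} [Fintype X] [Fintype Y] {P : X → ℝ}
    (hP : P ∈ stdSimplex ℝ X) {W : X → Y → ℝ} (hW : IsChannel W) :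
    outputDist P W ∈ stdSimplex ℝ Y := by
  refine ⟨fun y => Finset.sum_nonneg fun x _ => mul_nonneg (hP.1 x) ((hW x).1 y), ?_⟩
  simp only [outputDist]
  rw [Finset.sum_comm]
  simp only [← Finset.mul_sum, (hW _).2, mul_one, hP.2]

lemma joint_mem_stdSimplex {X Y : Type*} [Fintype X] [Fintype Y] {P : X → ℝ}
    (hP : P ∈ stdSimplex ℝ X) {W : X → Y → ℝ} (hW : IsChannel W) :
    (fun z : X × Y => P z.1 * W z.1 z.2) ∈ stdSimplex ℝ (X × Y) := by
  refine ⟨fun z => mul_nonneg (hP.1 _) ((hW _).1 _), ?_⟩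
  rw [Fintype.sum_prod_type]
  simp only [← Finset.mul_sum, (hW _).2, mul_one, hP.2]

/-- On the support of the joint distribution, both the channel and the output distribution are
positive. -/
lemma pos_of_joint_ne_zero {X Y : Type*} [Fintype X] [Fintype Y] {P : X → ℝ}
    (hP : P ∈ stdSimplex ℝ X) {W : X → Y → ℝ} (hW : IsChannel W) {x : X} {y : Y}
    (h : P x * W x y ≠ 0) : 0 < W x y ∧ 0 < outputDist P W y := by
  have h1 : 0 < P x * W x y := (mul_nonneg (hP.1 x) ((hW x).1 y)).lt_of_ne' h
  refine ⟨((hW x).1 y).lt_of_ne' (right_ne_zero_of_mul h), lt_of_lt_of_le h1 ?_⟩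
  exact Finset.single_le_sum (f := fun x => P x * W x y)
    (fun x _ => mul_nonneg (hP.1 x) ((hW x).1 y)) (Finset.mem_univ x)

lemma mutualInfo_nonneg {X Y : Type*} [Fintype X] [Fintype Y] {P : X → ℝ}
    (hP : P ∈ stdSimplex ℝ X) {W : X → Y → ℝ} (hW : IsChannel W) : 0 ≤ mutualInfo P W := by
  have h := sum_mul_logb_le (joint_mem_stdSimplex hP hW)
    (g := fun z => outputDist P W z.2 / W z.1 z.2) (M := 1)
    (fun z hz => div_pos (pos_of_joint_ne_zero hP hW hz).2 (pos_of_joint_ne_zero hP hW hz).1) ?_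
  · rw [Real.logb_one, Fintype.sum_prod_type] at h
    rw [mutualInfo_eq_sum, ← neg_nonpos]
    refine le_of_eq_of_le ?_ h
    simp only [← Finset.sum_neg_distrib]
    refine Finset.sum_congr rfl fun x _ => Finset.sum_congr rfl fun y _ => ?_
    by_cases hz : P x * W x y = 0
    · simp [hz]
    · obtain ⟨h1, h2⟩ := pos_of_joint_ne_zero hP hW hz
      rw [Real.logb_div h2.ne' h1.ne']
      ring
  · calc ∑ z : X × Y, P z.1 * W z.1 z.2 * (outputDist P W z.2 / W z.1 z.2)
        ≤ ∑ z : X × Y, P z.1 * outputDist P W z.2 := by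
          refine Finset.sum_le_sum fun z _ => ?_
          have hQ := (outputDist_mem_stdSimplex hP hW).1 z.2
          by_cases hz : W z.1 z.2 = 0
          · simpa [hz] using mul_nonneg (hP.1 _) hQ
          · exact le_of_eq (by field_simp)
      _ = 1 := by
          rw [Fintype.sum_prod_type]
          simp only [← Finset.mul_sum, (outputDist_mem_stdSimplex hP hW).2, mul_one, hP.2]

lemma continuous_mul_logb : Continuous fun x : ℝ => x * Real.logb 2 x := by
  simp only [Real.logb, ← mul_div_assoc]
  exact Real.continuous_mul_log.div_const _

lemma continuous_entropy {A : Type*} [Fintype A] : Continuous (entropy : (A → ℝ) → ℝ) :=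
  (continuous_finsetSum _ fun a _ => continuous_mul_logb.comp (continuous_apply a)).neg

lemma continuous_mutualInfo {X Y : Type*} [Fintype X] [Fintype Y] (P : X → ℝ) :
    Continuous (mutualInfo P : (X → Y → ℝ) → ℝ) := by
  refine Continuous.sub (continuous_entropy.comp ?_) ?_
  · unfold outputDist
    fun_prop
  · exact continuous_finsetSum _ fun x _ =>
      continuous_const.mul (continuous_entropy.comp (continuous_apply x))

lemma continuous_expDistortion {X Y : Type*} [Fintype X] [Fintype Y] (P : X → ℝ)
    (δ : X → Y → ℝ) : Continuous (expDistortion P δ) := by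
  unfold expDistortion
  fun_prop

lemma isCompact_setOf_isChannel {X Y : Type*} [Fintype Y] :
    IsCompact {W : X → Y → ℝ | IsChannel W} := by
  have h : {W : X → Y → ℝ | IsChannel W} = Set.univ.pi fun _ => stdSimplex ℝ Y := by
    ext W
    simp [IsChannel]
  rw [h]
  exact isCompact_univ_pi fun _ => isCompact_stdSimplex ℝ Y

lemma exists_feasible_minimizer {X Y : Type*} [Fintype X] [Fintype Y] (P : X → ℝ)
    (δ : X → Y → ℝ) (D : ℝ) (hne : (feasibleChannels P δ D).Nonempty) :
    ∃ W ∈ feasibleChannels P δ D, ∀ V ∈ feasibleChannels P δ D,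
      mutualInfo P W ≤ mutualInfo P V := by
  have hc : IsCompact (feasibleChannels P δ D) :=
    isCompact_setOf_isChannel.inter_right
      (isClosed_le (continuous_expDistortion P δ) continuous_const)
  obtain ⟨W, hW, h⟩ := hc.exists_isMinOn hne (continuous_mutualInfo P).continuousOn
  exact ⟨W, hW, fun V hV => h hV⟩

/-! ### Deterministic codes -/

/-- The deterministic code with encoding function `e` and codewords `c`. -/
noncomputable def deterministicCode {X Y : Type*} [Fintype Y] {n M : ℕ}
    (e : (Fin n → X) → Fin M) (c : Fin M → Fin n → Y) : BlockCode X Y n where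
  size := M
  enc x := Pi.single (e x) 1
  dec m := by classical exact Pi.single (c m) 1
  enc_isChannel x := single_mem_stdSimplex ℝ (e x)
  dec_isChannel m := by classical exact single_mem_stdSimplex ℝ (c m)

lemma deterministicCode_isDeterministic {X Y : Type*} [Fintype Y] {n M : ℕ}
    (e : (Fin n → X) → Fin M) (c : Fin M → Fin n → Y) :
    (deterministicCode e c).IsDeterministic :=
  ⟨fun x => ⟨e x, Pi.single_eq_same _ _⟩,
    fun m => ⟨c m, by classical exact Pi.single_eq_same (M := fun _ => ℝ) _ _⟩⟩

lemma deterministicCode_distortion {X Y : Type*} [Fintype X] [Fintype Y] (P : X → ℝ)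
    (δ : X → Y → ℝ) {n M : ℕ} (e : (Fin n → X) → Fin M) (c : Fin M → Fin n → Y) :
    (deterministicCode e c).distortion P δ =
      ∑ x, powDist P x * wordDistortion δ x (c (e x)) := by
  classical
  unfold BlockCode.distortion
  refine Finset.sum_congr rfl fun x _ => ?_
  congr 1
  change ∑ m : Fin M, (Pi.single (e x) 1 : Fin M → ℝ) m *
    ∑ y, (Pi.single (c m) 1 : (Fin n → Y) → ℝ) y * wordDistortion δ x y = _
  rw [Fintype.sum_eq_single (e x) fun m hm => by simp [Pi.single_eq_of_ne hm],
    Fintype.sum_eq_single (c (e x)) fun y hy => by simp [Pi.single_eq_of_ne hy]]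
  simp

/-- A code can be derandomized: replace the decoder by the best output word for each index, then
the encoder by the best index for each source word. A minimum never exceeds an average, so neither
step increases the distortion. -/
lemma exists_deterministic_distortion_le {X Y : Type*} [Fintype X] [Fintype Y] {P : X → ℝ}
    (hP : P ∈ stdSimplex ℝ X) (δ : X → Y → ℝ) {n : ℕ} (K : BlockCode X Y n) :
    ∃ K' : BlockCode X Y n, K'.IsDeterministic ∧ K'.rate = K.rate ∧
      K'.distortion P δ ≤ K.distortion P δ := by
  have h1 := fun m => exists_le_weighted_sum (K.dec_isChannel m)
    fun y => ∑ x, powDist P x * (K.enc x m * wordDistortion δ x y)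
  choose c hc using h1
  have h2 := fun x => exists_le_weighted_sum (K.enc_isChannel x)
    fun m => wordDistortion δ x (c m)
  choose e he using h2
  refine ⟨deterministicCode e c, deterministicCode_isDeterministic e c, rfl, ?_⟩
  rw [deterministicCode_distortion]
  calc ∑ x, powDist P x * wordDistortion δ x (c (e x))
      ≤ ∑ x, powDist P x * ∑ m, K.enc x m * wordDistortion δ x (c m) :=
        Finset.sum_le_sum fun x _ =>
          mul_le_mul_of_nonneg_left (he x) ((powDist_mem_stdSimplex hP n).1 x)
    _ = ∑ m, ∑ x, powDist P x * (K.enc x m * wordDistortion δ x (c m)) := by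
        simp only [Finset.mul_sum]
        exact Finset.sum_comm
    _ ≤ ∑ m, ∑ y, K.dec m y * ∑ x, powDist P x * (K.enc x m * wordDistortion δ x y) :=
        Finset.sum_le_sum fun m _ => hc m
    _ = K.distortion P δ := by
        unfold BlockCode.distortion
        simp only [Finset.mul_sum]
        rw [Finset.sum_comm (s := (Finset.univ : Finset (Fin n → X)))]
        refine Finset.sum_congr rfl fun m _ => ?_
        rw [Finset.sum_comm]
        refine Finset.sum_congr rfl fun x _ => Finset.sum_congr rfl fun y _ => ?_
        ring

lemma achievable_iff_achievableDet {X Y : Type*} [Fintype X] [Fintype Y] {P : X → ℝ}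
    (hP : P ∈ stdSimplex ℝ X) (δ : X → Y → ℝ) (R D : ℝ) :
    Achievable P δ R D ↔ AchievableDet P δ R D := by
  constructor
  · rintro ⟨hR, hD, K, -, hrate, hdist⟩
    choose K' hdet hrate' hle using fun n => exists_deterministic_distortion_le hP δ (K n)
    refine ⟨hR, hD, K', hdet, by simpa only [hrate'] using hrate, fun ε hε => ?_⟩
    filter_upwards [hdist ε hε] with n hn using (hle n).trans hn
  · rintro ⟨hR, hD, K, -, hrate, hdist⟩
    exact ⟨hR, hD, K, fun _ => trivial, hrate, hdist⟩

/-! ### The converse -/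

/-- **Single-letterization.** Let `V` be a channel between words which is dominated, uniformly in
the input word, by a weight `v` of total mass `M` on the output words. The average `W` of its
single-letter marginals has the same distortion per letter, and `n I(P;W) ≤ log M`. The latter is
Gibbs' inequality for `∏ₖ W(yₖ|xₖ) / PW(yₖ)`: for each fixed output word its average over the
source words is at most `1`, so its average over `Pⁿ V` is at most `M`. -/
lemma exists_singleLetter_channel {X Y : Type*} [Fintype X] [Fintype Y] {P : X → ℝ}
    (hP : P ∈ stdSimplex ℝ X) (δ : X → Y → ℝ) {n : ℕ} (hn : n ≠ 0)
    {V : (Fin n → X) → (Fin n → Y) → ℝ} (hV : IsChannel V) {v : (Fin n → Y) → ℝ}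
    (hVv : ∀ x y, V x y ≤ v y) {M : ℝ} (hM : ∑ y, v y ≤ M) :
    ∃ W : X → Y → ℝ, IsChannel W ∧
      n * expDistortion P δ W = ∑ x, ∑ y, powDist P x * V x y * wordDistortion δ x y ∧
      n * mutualInfo P W ≤ Real.logb 2 M := by
  classical
  have hPn := powDist_mem_stdSimplex hP n
  have hn0 : (n : ℝ) ≠ 0 := Nat.cast_ne_zero.2 hn
  obtain ⟨x₀⟩ := nonempty_of_mem_stdSimplex hPn
  obtain ⟨y₀⟩ := nonempty_of_mem_stdSimplex (hV x₀)
  -- `J` is `n` times the joint distribution of a letter pair in a uniformly chosen position.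
  let r : (((Fin n → X) × (Fin n → Y)) × Fin n) → ℝ := fun ω => powDist P ω.1.1 * V ω.1.1 ω.1.2
  let φ : (((Fin n → X) × (Fin n → Y)) × Fin n) → X × Y := fun ω => (ω.1.1 ω.2, ω.1.2 ω.2)
  let J : X × Y → ℝ := fun z => ∑ ω, if φ ω = z then r ω else 0
  have hr : ∀ ω, 0 ≤ r ω := fun ω => mul_nonneg (hPn.1 _) ((hV _).1 _)
  have hJ0 : ∀ z, 0 ≤ J z := fun z =>
    Finset.sum_nonneg fun ω _ => by split_ifs; exacts [hr ω, le_rfl]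
  have hJf : ∀ f : X × Y → ℝ, ∑ z, J z * f z =
      ∑ x, ∑ y, powDist P x * V x y * ∑ k, f (x k, y k) := by
    intro f
    refine (sum_pushforward_mul r φ f).trans ?_
    rw [Fintype.sum_prod_type, Fintype.sum_prod_type]
    simp only [Finset.mul_sum, r, φ]
  have hmarg : ∀ a, ∑ b, J (a, b) = n * P a := by
    intro a
    have h : _ = ∑ x, ∑ y, powDist P x * V x y * ∑ k, if x k = a then (1 : ℝ) else 0 :=
      hJf fun z => if z.1 = a then 1 else 0
    rw [Fintype.sum_prod_type] at h
    simp only [mul_ite, mul_one, mul_zero] at h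
    rw [Finset.sum_eq_single a (fun b _ hb => by simp [hb]) (by simp)] at h
    simp only [if_true] at h
    rw [h]
    have hx : ∀ (x : Fin n → X) (s : ℝ), ∑ y, powDist P x * V x y * s = powDist P x * s := by
      intro x s
      rw [← Finset.sum_mul, ← Finset.mul_sum, (hV x).2, mul_one]
    simp only [hx]
    simp only [Finset.mul_sum, mul_ite, mul_one, mul_zero]
    rw [Finset.sum_comm]
    simp only [sum_powDist_eval hP]
    simp
  -- Disintegration of `J`; letters of probability zero get an arbitrary output distribution.
  let W : X → Y → ℝ := fun a b =>
    if P a = 0 then (Pi.single (y₀ ⟨0, Nat.pos_of_ne_zero hn⟩) 1 : Y → ℝ) b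
    else J (a, b) / (n * P a)
  have hW : IsChannel W := by
    intro a
    by_cases ha : P a = 0
    · simpa [W, ha] using single_mem_stdSimplex ℝ (y₀ ⟨0, Nat.pos_of_ne_zero hn⟩)
    · simp only [W, ha, if_false]
      refine ⟨fun b => div_nonneg (hJ0 _) (mul_nonneg n.cast_nonneg (hP.1 a)), ?_⟩
      rw [← Finset.sum_div, hmarg, div_self (mul_ne_zero hn0 ha)]
  have hPW : ∀ a b, n * (P a * W a b) = J (a, b) := by
    intro a b
    by_cases ha : P a = 0
    · have h := hmarg a
      rw [ha, mul_zero, Finset.sum_eq_zero_iff_of_nonneg fun b _ => hJ0 _] at h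
      simp [ha, h b (Finset.mem_univ b)]
    · simp only [W, ha, if_false]
      field_simp
  have hexp : ∀ f : X → Y → ℝ, n * ∑ a, ∑ b, P a * W a b * f a b =
      ∑ x, ∑ y, powDist P x * V x y * ∑ k, f (x k) (y k) := by
    intro f
    rw [← hJf fun z => f z.1 z.2, Fintype.sum_prod_type]
    simp only [Finset.mul_sum, ← hPW, mul_assoc]
  refine ⟨W, hW, hexp δ, ?_⟩
  rw [mutualInfo_eq_sum, hexp fun a b => Real.logb 2 (W a b) - Real.logb 2 (outputDist P W b)]
  have hpos : ∀ x y, powDist P x * V x y ≠ 0 → ∀ k,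
      0 < W (x k) (y k) ∧ 0 < outputDist P W (y k) := by
    intro x y hxy k
    refine pos_of_joint_ne_zero hP hW fun h => hxy ?_
    have h1 := hPW (x k) (y k)
    rw [h, mul_zero, eq_comm, Finset.sum_eq_zero_iff_of_nonneg
      fun ω _ => by split_ifs; exacts [hr ω, le_rfl]] at h1
    simpa [φ, r] using h1 ((x, y), k) (Finset.mem_univ _)
  have hv0 : ∀ y, 0 ≤ v y := fun y => ((hV x₀).1 y).trans (hVv x₀ y)
  have hQ0 := (outputDist_mem_stdSimplex hP hW).1
  have hg0 : ∀ (x : Fin n → X) (y : Fin n → Y),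
      0 ≤ ∏ k, W (x k) (y k) / outputDist P W (y k) := fun x y =>
    Finset.prod_nonneg fun k _ => div_nonneg ((hW _).1 _) (hQ0 _)
  have hsum : ∑ z : (Fin n → X) × (Fin n → Y), powDist P z.1 * V z.1 z.2 *
      ∏ k, W (z.1 k) (z.2 k) / outputDist P W (z.2 k) ≤ M := by
    calc ∑ z : (Fin n → X) × (Fin n → Y), powDist P z.1 * V z.1 z.2 *
          ∏ k, W (z.1 k) (z.2 k) / outputDist P W (z.2 k)
        ≤ ∑ z : (Fin n → X) × (Fin n → Y), powDist P z.1 * v z.2 *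
          ∏ k, W (z.1 k) (z.2 k) / outputDist P W (z.2 k) := by
          refine Finset.sum_le_sum fun z _ => mul_le_mul_of_nonneg_right ?_ (hg0 _ _)
          exact mul_le_mul_of_nonneg_left (hVv _ _) (hPn.1 _)
      _ = ∑ y, v y * ∏ k, (outputDist P W (y k) / outputDist P W (y k)) := by
          rw [Fintype.sum_prod_type_right]
          refine Finset.sum_congr rfl fun y _ => ?_
          have h : ∀ k, outputDist P W (y k) / outputDist P W (y k) =
              ∑ a, P a * (W a (y k) / outputDist P W (y k)) := by
            intro k
            simp only [← mul_div_assoc]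
            rw [← Finset.sum_div]
            rfl
          simp only [h]
          rw [Fintype.prod_sum, Finset.mul_sum]
          refine Finset.sum_congr rfl fun x _ => ?_
          rw [Finset.prod_mul_distrib, powDist]
          ring
      _ ≤ ∑ y, v y := by
          refine Finset.sum_le_sum fun y _ => mul_le_of_le_one_right (hv0 y) ?_
          exact Finset.prod_le_one (fun k _ => div_nonneg (hQ0 _) (hQ0 _))
            fun k _ => div_self_le_one _
      _ ≤ M := hM
  have hG := sum_mul_logb_le (joint_mem_stdSimplex hPn hV)
    (fun z hz => Finset.prod_pos fun k _ =>
      div_pos (hpos z.1 z.2 hz k).1 (hpos z.1 z.2 hz k).2) hsum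
  refine le_of_eq_of_le ?_ hG
  rw [Fintype.sum_prod_type]
  refine Finset.sum_congr rfl fun x _ => Finset.sum_congr rfl fun y _ => ?_
  by_cases hxy : powDist P x * V x y = 0
  · simp [hxy]
  · have h := hpos x y hxy
    rw [Real.logb_prod _ _ fun k _ => (div_pos (h k).1 (h k).2).ne']
    congr 1
    exact Finset.sum_congr rfl fun k _ => (Real.logb_div (h k).1.ne' (h k).2.ne').symm

lemma BlockCode.exists_channel {X Y : Type*} [Fintype X] [Fintype Y] {P : X → ℝ}
    (hP : P ∈ stdSimplex ℝ X) (δ : X → Y → ℝ) {n : ℕ} (hn : n ≠ 0) (K : BlockCode X Y n) :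
    ∃ W : X → Y → ℝ, IsChannel W ∧ n * expDistortion P δ W = K.distortion P δ ∧
      mutualInfo P W ≤ K.rate := by
  obtain ⟨W, hW, hd, hI⟩ := exists_singleLetter_channel hP δ hn
    (V := fun x y => ∑ c, K.enc x c * K.dec c y) (v := fun y => ∑ c, K.dec c y) (M := K.size)
    (fun x => ⟨fun y => Finset.sum_nonneg fun c _ =>
        mul_nonneg ((K.enc_isChannel x).1 c) ((K.dec_isChannel c).1 y), by
      rw [Finset.sum_comm]
      simp only [← Finset.mul_sum, (K.dec_isChannel _).2, mul_one, (K.enc_isChannel x).2]⟩)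
    (fun x y => Finset.sum_le_sum fun c _ => mul_le_of_le_one_left ((K.dec_isChannel c).1 y)
      ((Finset.single_le_sum (fun c _ => (K.enc_isChannel x).1 c) (Finset.mem_univ c)).trans_eq
        (K.enc_isChannel x).2))
    (by rw [Finset.sum_comm]; simp [(K.dec_isChannel _).2])
  refine ⟨W, hW, hd.trans ?_, ?_⟩
  · unfold BlockCode.distortion
    refine Finset.sum_congr rfl fun x _ => ?_
    simp only [Finset.mul_sum, Finset.sum_mul]
    rw [Finset.sum_comm]
    refine Finset.sum_congr rfl fun c _ => Finset.sum_congr rfl fun y _ => ?_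
    ring
  · rw [BlockCode.rate, le_div_iff₀ (by positivity)]
    linarith

/-- The converse: by compactness of the set of channels, the single-letter channels of a sequence
of codes have a limit point. -/
lemma Achievable.exists_feasible {X Y : Type*} [Fintype X] [Fintype Y] {P : X → ℝ}
    (hP : P ∈ stdSimplex ℝ X) {δ : X → Y → ℝ} {R D : ℝ} (h : Achievable P δ R D) :
    ∃ W ∈ feasibleChannels P δ D, mutualInfo P W ≤ R := by
  obtain ⟨-, -, K, -, hrate, hdist⟩ := h
  choose W hW hd hI using fun n : ℕ => (K (n + 1)).exists_channel hP δ n.succ_ne_zero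
  obtain ⟨W₀, hW₀, φ, hφ, hlim⟩ := isCompact_setOf_isChannel.tendsto_subseq hW
  have hφ1 : Tendsto (fun i => φ i + 1) atTop atTop :=
    (tendsto_add_atTop_nat 1).comp hφ.tendsto_atTop
  refine ⟨W₀, ⟨hW₀, le_of_forall_pos_le_add fun ε hε => ?_⟩, ?_⟩
  · refine le_of_tendsto (((continuous_expDistortion P δ).tendsto W₀).comp hlim) ?_
    filter_upwards [hφ1.eventually (hdist ε hε)] with i hi
    rw [← hd] at hi
    exact le_of_mul_le_mul_left hi (by positivity)
  · exact le_of_tendsto_of_tendsto' (((continuous_mutualInfo P).tendsto W₀).comp hlim)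
      (hrate.comp hφ1) fun i => hI (φ i)

/-! ### A one-shot covering lemma -/

/-- **Covering lemma.** Suppose that `s * V x y ≤ q y` whenever `A x y`. Among `M` independent
samples from `q`, the probability that none is `A`-related to a source symbol drawn from `p` is at
most the probability that `A` fails under `p` and `V`, plus `exp (-s M)`. In particular some choice
of the `M` codewords is that good. -/
lemma exists_covering {S T : Type*} [Fintype S] [Fintype T] {p : S → ℝ}
    (hp : p ∈ stdSimplex ℝ S) {q : T → ℝ} (hq : q ∈ stdSimplex ℝ T) {V : S → T → ℝ}
    (hV : IsChannel V) (A : S → T → Prop) [∀ x y, Decidable (A x y)] {s : ℝ}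
    (hA : ∀ x y, A x y → s * V x y ≤ q y) (M : ℕ) :
    ∃ c : Fin M → T, ∑ x, (if ∀ m, ¬A x (c m) then p x else 0) ≤
      ∑ x, ∑ y, (if A x y then 0 else p x * V x y) + Real.exp (-(s * M)) := by
  obtain ⟨c, hc⟩ := exists_le_weighted_sum (powDist_mem_stdSimplex hq M)
    fun c => ∑ x, (if ∀ m, ¬A x (c m) then p x else 0)
  refine ⟨c, hc.trans ?_⟩
  have hmiss : ∀ x, (∑ y, if A x y then 0 else q y) ^ M ≤
      ∑ y, (if A x y then 0 else V x y) + Real.exp (-(s * M)) := by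
    intro x
    have hq1 : ∑ y, (if A x y then 0 else q y) = 1 - ∑ y, (if A x y then q y else 0) := by
      rw [← hq.2, ← Finset.sum_sub_distrib]
      exact Finset.sum_congr rfl fun y _ => by split_ifs <;> simp
    have hV1 : ∑ y, (if A x y then 0 else V x y) = 1 - ∑ y, (if A x y then V x y else 0) := by
      rw [← (hV x).2, ← Finset.sum_sub_distrib]
      exact Finset.sum_congr rfl fun y _ => by split_ifs <;> simp
    have hnn : 0 ≤ ∑ y, (if A x y then 0 else q y) :=
      Finset.sum_nonneg fun y _ => by split_ifs; exacts [le_rfl, hq.1 y]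
    have hVnn : 0 ≤ ∑ y, (if A x y then 0 else V x y) :=
      Finset.sum_nonneg fun y _ => by split_ifs; exacts [le_rfl, (hV x).1 y]
    have hw0 : 0 ≤ ∑ y, (if A x y then V x y else 0) :=
      Finset.sum_nonneg fun y _ => by split_ifs; exacts [(hV x).1 y, le_rfl]
    have hsw : s * ∑ y, (if A x y then V x y else 0) ≤ ∑ y, (if A x y then q y else 0) := by
      rw [Finset.mul_sum]
      refine Finset.sum_le_sum fun y _ => ?_
      split_ifs with h
      · exact hA x y h
      · simp
    rw [hV1] at hVnn ⊢
    set w := ∑ y, (if A x y then V x y else 0)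
    calc (∑ y, if A x y then 0 else q y) ^ M ≤ Real.exp (-(s * w)) ^ M := by
          refine pow_le_pow_left₀ hnn ?_ M
          rw [hq1]
          exact (Real.one_sub_le_exp_neg _).trans (Real.exp_le_exp.2 (neg_le_neg hsw))
      _ = Real.exp ((1 - w) * 0 + w * (-(s * M))) := by
          rw [← Real.exp_nat_mul]
          congr 1
          ring
      _ ≤ (1 - w) * Real.exp 0 + w * Real.exp (-(s * M)) :=
          convexOn_exp.2 trivial trivial hVnn hw0 (by ring)
      _ ≤ 1 - w + Real.exp (-(s * M)) := by
          rw [Real.exp_zero, mul_one]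
          exact add_le_add_right (mul_le_of_le_one_left (Real.exp_pos _).le (by linarith)) _
  calc ∑ c : Fin M → T, powDist q c * ∑ x, (if ∀ m, ¬A x (c m) then p x else 0)
      = ∑ x, p x * (∑ y, if A x y then 0 else q y) ^ M := by
        simp only [Finset.mul_sum]
        rw [Finset.sum_comm]
        refine Finset.sum_congr rfl fun x _ => ?_
        rw [Fintype.sum_pow, Finset.mul_sum]
        refine Finset.sum_congr rfl fun c _ => ?_
        by_cases h : ∀ m, ¬A x (c m)
        · simp [h, powDist, mul_comm]
        · rw [if_neg h]
          push Not at h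
          obtain ⟨m, hm⟩ := h
          rw [Finset.prod_eq_zero (Finset.mem_univ m) (by simp [hm])]
          simp
    _ ≤ ∑ x, p x * (∑ y, (if A x y then 0 else V x y) + Real.exp (-(s * M))) :=
        Finset.sum_le_sum fun x _ => mul_le_mul_of_nonneg_left (hmiss x) (hp.1 x)
    _ = _ := by
        simp only [mul_add, Finset.sum_add_distrib, ← Finset.sum_mul, hp.2, one_mul,
          Finset.mul_sum, mul_ite, mul_zero]

/-! ### The upper tail of a sum of independent variables -/

open Classical in
/-- The probability that the mean of `h` over `n` independent samples from `p` exceeds `t`. -/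
noncomputable def tailProb {A : Type*} [Fintype A] (p h : A → ℝ) (t : ℝ) (n : ℕ) : ℝ :=
  ∑ z : Fin n → A, if n * t < ∑ k, h (z k) then powDist p z else 0

lemma tailProb_nonneg {A : Type*} [Fintype A] {p : A → ℝ} (hp : p ∈ stdSimplex ℝ A) (h : A → ℝ)
    (t : ℝ) (n : ℕ) : 0 ≤ tailProb p h t n :=
  Finset.sum_nonneg fun z _ => by
    split_ifs
    exacts [(powDist_mem_stdSimplex hp n).1 z, le_rfl]

/-- The weak law of large numbers (upper tail), from the exponential Markov inequality. -/
lemma tendsto_tailProb {A : Type*} [Fintype A] {p : A → ℝ} (hp : p ∈ stdSimplex ℝ A)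
    {h : A → ℝ} {t : ℝ} (ht : ∑ a, p a * h a < t) :
    Tendsto (tailProb p h t) atTop (𝓝 0) := by
  set ε := t - ∑ a, p a * h a with hε
  have hε0 : 0 < ε := sub_pos.2 ht
  set B := 1 + ε + ∑ a, |h a - t| with hB
  have hB1 : 1 + ε ≤ B := le_add_of_nonneg_right (Finset.sum_nonneg fun a _ => abs_nonneg _)
  have hBa : ∀ a, |h a - t| ≤ B := fun a =>
    (Finset.single_le_sum (f := fun a => |h a - t|) (fun a _ => abs_nonneg _)
      (Finset.mem_univ a)).trans (by linarith)
  have hB0 : 0 < B := by linarith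
  -- For this exponent, `exp u ≤ 1 + u + u²` shows that the exponential moment is less than `1`.
  set l := ε / (2 * B ^ 2) with hl
  have hl0 : 0 < l := by positivity
  have hlB : l * B ≤ 1 := by
    have : l * B = ε / (2 * B) := by rw [hl]; field_simp
    rw [this, div_le_one (by positivity)]
    linarith
  set ρ := ∑ a, p a * Real.exp (l * (h a - t)) with hρ
  have hρ0 : 0 ≤ ρ := Finset.sum_nonneg fun a _ => mul_nonneg (hp.1 a) (Real.exp_pos _).le
  have hρ1 : ρ < 1 := by
    calc ρ ≤ ∑ a, p a * (1 + l * (h a - t) + (l * B) ^ 2) := by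
          refine Finset.sum_le_sum fun a _ => mul_le_mul_of_nonneg_left ?_ (hp.1 a)
          have h1 : |l * (h a - t)| ≤ l * B := by
            rw [abs_mul, abs_of_pos hl0]
            exact mul_le_mul_of_nonneg_left (hBa a) hl0.le
          have h2 := (abs_le.1 (Real.abs_exp_sub_one_sub_id_le (h1.trans hlB))).2
          have h3 : (l * (h a - t)) ^ 2 ≤ (l * B) ^ 2 :=
            sq_le_sq' (abs_le.1 h1).1 (abs_le.1 h1).2
          linarith
      _ = ∑ a, (p a * (1 - l * t + (l * B) ^ 2) + l * (p a * h a)) :=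
          Finset.sum_congr rfl fun a _ => by ring
      _ = 1 - l * ε + (l * B) ^ 2 := by
          rw [Finset.sum_add_distrib, ← Finset.sum_mul, hp.2, ← Finset.mul_sum, hε]
          ring
      _ < 1 := by
          have : (l * B) ^ 2 = l * ε / 2 := by rw [hl]; field_simp
          nlinarith [mul_pos hl0 hε0]
  refine squeeze_zero (tailProb_nonneg hp h t) (fun n => ?_)
    (tendsto_pow_atTop_nhds_zero_of_lt_one hρ0 hρ1)
  rw [hρ, Fintype.sum_pow]
  refine Finset.sum_le_sum fun z _ => ?_
  rw [Finset.prod_mul_distrib, ← Real.exp_sum, ← Finset.mul_sum, Finset.sum_sub_distrib]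
  have hz := (powDist_mem_stdSimplex hp n).1 z
  change _ ≤ powDist p z * _
  split_ifs with hlt
  · refine le_mul_of_one_le_right hz (Real.one_le_exp (mul_nonneg hl0.le ?_))
    simp only [Finset.sum_const, Finset.card_univ, Fintype.card_fin, nsmul_eq_mul]
    linarith
  · exact mul_nonneg hz (Real.exp_pos _).le

/-! ### The direct part -/

/-- The information density `log (W x y / PW y)` of a pair of letters. -/
noncomputable def infoDensity {X Y : Type*} [Fintype X] (P : X → ℝ) (W : X → Y → ℝ)
    (z : X × Y) : ℝ :=
  Real.logb 2 (W z.1 z.2) - Real.logb 2 (outputDist P W z.2)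

/-- A pair of words drawn from the source and the memoryless channel is likely to have information
density at most `n r` and distortion at most `n d`. The first property is stated without
logarithms, as in `exists_covering`. -/
lemma sum_not_typical_le {X Y : Type*} [Fintype X] [Fintype Y] {P : X → ℝ}
    (hP : P ∈ stdSimplex ℝ X) (δ : X → Y → ℝ) {W : X → Y → ℝ} (hW : IsChannel W) (n : ℕ)
    (r d : ℝ) (A : (Fin n → X) → (Fin n → Y) → Prop) [∀ x y, Decidable (A x y)]
    (hA : ∀ x y, (2 : ℝ) ^ (-(n * r)) * ∏ k, W (x k) (y k) ≤ powDist (outputDist P W) y →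
      wordDistortion δ x y ≤ n * d → A x y) :
    ∑ x : Fin n → X, ∑ y : Fin n → Y,
        (if A x y then 0 else powDist P x * ∏ k, W (x k) (y k)) ≤
      tailProb (fun z : X × Y => P z.1 * W z.1 z.2) (infoDensity P W) r n +
      tailProb (fun z : X × Y => P z.1 * W z.1 z.2) (fun z => δ z.1 z.2) d n := by
  rw [tailProb, tailProb, ← Finset.sum_add_distrib, ← Fintype.sum_prod_type',
    ← (Equiv.arrowProdEquivProdArrow (Fin n) (fun _ => X) (fun _ => Y)).sum_comp]
  refine Finset.sum_le_sum fun z _ => ?_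
  have hz : powDist (fun z : X × Y => P z.1 * W z.1 z.2) z =
      powDist P (fun k => (z k).1) * ∏ k, W (z k).1 (z k).2 := Finset.prod_mul_distrib
  have hz0 := (powDist_mem_stdSimplex (joint_mem_stdSimplex hP hW) n).1 z
  change (if A (fun k => (z k).1) (fun k => (z k).2) then 0 else
    powDist P (fun k => (z k).1) * ∏ k, W (z k).1 (z k).2) ≤ _
  rw [← hz]
  set m := powDist (fun z : X × Y => P z.1 * W z.1 z.2) z with hm
  have hnn : ∀ (c : Prop) [Decidable c], 0 ≤ if c then m else 0 := fun c _ => by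
    split_ifs
    exacts [hz0, le_rfl]
  by_cases hAz : A (fun k => (z k).1) (fun k => (z k).2)
  · rw [if_pos hAz]
    exact add_nonneg (hnn _) (hnn _)
  rw [if_neg hAz]
  by_cases hd : n * d < ∑ k, δ (z k).1 (z k).2
  · rw [if_pos hd]
    exact le_add_of_nonneg_left (hnn _)
  by_cases hm0 : m = 0
  · simp [hm0]
  rw [if_pos, if_neg hd, add_zero]
  have hpos : ∀ k, 0 < W (z k).1 (z k).2 ∧ 0 < outputDist P W (z k).2 := fun k =>
    pos_of_joint_ne_zero hP hW (Finset.prod_ne_zero_iff.1 hm0 k (Finset.mem_univ k))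
  have h1 : powDist (outputDist P W) (fun k => (z k).2) <
      (2 : ℝ) ^ (-(n * r)) * ∏ k, W (z k).1 (z k).2 := by
    by_contra! h
    exact hAz (hA _ _ h (not_lt.1 hd))
  have hQ : 0 < powDist (outputDist P W) (fun k => (z k).2) :=
    Finset.prod_pos fun k _ => (hpos k).2
  have hWp : 0 < ∏ k, W (z k).1 (z k).2 := Finset.prod_pos fun k _ => (hpos k).1
  have h2 := Real.logb_lt_logb (b := 2) (by norm_num) hQ h1
  rw [Real.logb_mul (by positivity) hWp.ne', Real.logb_rpow (by norm_num) (by norm_num),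
    Real.logb_prod _ _ fun k _ => (hpos k).1.ne', powDist,
    Real.logb_prod _ _ fun k _ => (hpos k).2.ne'] at h2
  simp only [infoDensity, Finset.sum_sub_distrib]
  linarith

/-- Random coding at a fixed block length: a code with `M` codewords whose distortion exceeds `n d`
only through the source words that no codeword covers. -/
lemma exists_code_of_size {X Y : Type*} [Fintype X] [Fintype Y] {P : X → ℝ}
    (hP : P ∈ stdSimplex ℝ X) {δ : X → Y → ℝ} (hδ : ∀ x y, 0 ≤ δ x y) {W : X → Y → ℝ}
    (hW : IsChannel W) (n : ℕ) (r : ℝ) {d : ℝ} (hd : 0 ≤ d) {M : ℕ} (hM : 0 < M) :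
    ∃ K : BlockCode X Y n, K.size = M ∧ K.distortion P δ ≤ n * d + n * (∑ x, ∑ y, δ x y) *
      (tailProb (fun z : X × Y => P z.1 * W z.1 z.2) (infoDensity P W) r n +
        tailProb (fun z : X × Y => P z.1 * W z.1 z.2) (fun z => δ z.1 z.2) d n +
        Real.exp (-((2 : ℝ) ^ (-(n * r)) * M))) := by
  classical
  have hPn := powDist_mem_stdSimplex hP n
  let A : (Fin n → X) → (Fin n → Y) → Prop := fun x y =>
    (2 : ℝ) ^ (-(n * r)) * ∏ k, W (x k) (y k) ≤ powDist (outputDist P W) y ∧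
      wordDistortion δ x y ≤ n * d
  have hVn : IsChannel fun (x : Fin n → X) (y : Fin n → Y) => ∏ k, W (x k) (y k) := fun x =>
    ⟨fun y => Finset.prod_nonneg fun k _ => (hW _).1 _, by
      rw [← Fintype.prod_sum (f := fun k b => W (x k) b)]
      simp [(hW _).2]⟩
  obtain ⟨c, hc⟩ := exists_covering hPn
    (powDist_mem_stdSimplex (outputDist_mem_stdSimplex hP hW) n) hVn A
    (fun x y h => h.1) M
  have hc' := hc.trans (add_le_add_left
    (sum_not_typical_le hP δ hW n r d A fun x y h1 h2 => ⟨h1, h2⟩) _)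
  have he : ∀ x, ∃ m, (∃ m', A x (c m')) → A x (c m) := fun x => by
    by_cases h : ∃ m', A x (c m')
    · exact ⟨h.choose, fun _ => h.choose_spec⟩
    · exact ⟨⟨0, hM⟩, fun h' => absurd h' h⟩
  choose e he using he
  refine ⟨deterministicCode e c, rfl, ?_⟩
  rw [deterministicCode_distortion]
  have hΔ0 : 0 ≤ ∑ x, ∑ y, δ x y :=
    Finset.sum_nonneg fun x _ => Finset.sum_nonneg fun y _ => hδ x y
  have hΔ : ∀ x y, δ x y ≤ ∑ x, ∑ y, δ x y := fun x y =>
    (Finset.single_le_sum (f := fun y => δ x y) (fun y _ => hδ x y) (Finset.mem_univ y)).trans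
      (Finset.single_le_sum (f := fun x => ∑ y, δ x y)
        (fun x _ => Finset.sum_nonneg fun y _ => hδ x y) (Finset.mem_univ x))
  set Δ := ∑ x, ∑ y, δ x y
  calc ∑ x, powDist P x * wordDistortion δ x (c (e x))
      ≤ ∑ x, (powDist P x * (n * d) +
          n * Δ * (if ∀ m, ¬A x (c m) then powDist P x else 0)) := by
        refine Finset.sum_le_sum fun x _ => ?_
        by_cases h : ∃ m, A x (c m)
        · rw [if_neg (by push Not; exact h), mul_zero, add_zero]
          exact mul_le_mul_of_nonneg_left (he x h).2 (hPn.1 x)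
        · rw [if_pos (by push Not at h; exact h)]
          have h1 : wordDistortion δ x (c (e x)) ≤ n * Δ := by
            refine (Finset.sum_le_sum fun k _ => hΔ (x k) (c (e x) k)).trans_eq ?_
            simp
          have h2 := mul_le_mul_of_nonneg_left h1 (hPn.1 x)
          have h3 : 0 ≤ powDist P x * (n * d) := mul_nonneg (hPn.1 x) (by positivity)
          linarith
    _ = n * d + n * Δ * ∑ x, (if ∀ m, ¬A x (c m) then powDist P x else 0) := by
        rw [Finset.sum_add_distrib, ← Finset.sum_mul, hPn.2, one_mul, ← Finset.mul_sum]
    _ ≤ _ := add_le_add_right (mul_le_mul_of_nonneg_left hc' (by positivity)) _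

lemma eventually_exists_code {X Y : Type*} [Fintype X] [Fintype Y] {P : X → ℝ}
    (hP : P ∈ stdSimplex ℝ X) {δ : X → Y → ℝ} (hδ : ∀ x y, 0 ≤ δ x y) {D : ℝ} (hD : 0 ≤ D)
    {W : X → Y → ℝ} (hW : W ∈ feasibleChannels P δ D) {η : ℝ} (hη : 0 < η) :
    ∀ᶠ n : ℕ in atTop, ∃ K : BlockCode X Y n,
      |K.rate - mutualInfo P W| ≤ η ∧ K.distortion P δ ≤ n * (D + η) := by
  obtain ⟨hWc, hWD⟩ := hW
  set I := mutualInfo P W with hI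
  have hI0 : 0 ≤ I := mutualInfo_nonneg hP hWc
  set ε := η / 3 with hε
  have hε0 : 0 < ε := by positivity
  have hJ := joint_mem_stdSimplex hP hWc
  have ht1 := tendsto_tailProb hJ (h := infoDensity P W) (t := I + ε) (by
    rw [Fintype.sum_prod_type, hI, mutualInfo_eq_sum]
    exact lt_add_of_pos_right _ hε0)
  have ht2 := tendsto_tailProb hJ (h := fun z => δ z.1 z.2) (t := D + ε) (by
    rw [Fintype.sum_prod_type]
    exact lt_of_le_of_lt hWD (lt_add_of_pos_right _ hε0))
  have ht3 : Tendsto (fun n : ℕ => Real.exp (-((2 : ℝ) ^ ε) ^ n)) atTop (𝓝 0) :=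
    Real.tendsto_exp_neg_atTop_nhds_zero.comp
      (tendsto_pow_atTop_atTop_of_one_lt (Real.one_lt_rpow (by norm_num) hε0))
  have ht := ((ht1.add ht2).add ht3).const_mul (∑ x, ∑ y, δ x y)
  simp only [add_zero, mul_zero] at ht
  have hlin : Tendsto (fun n : ℕ => (n : ℝ) * ε) atTop atTop :=
    tendsto_natCast_atTop_atTop.atTop_mul_const hε0
  filter_upwards [ht.eventually (ge_mem_nhds hε0), hlin.eventually_ge_atTop 1,
    eventually_gt_atTop 0] with n hn hn1 hn0
  have hn0' : (0 : ℝ) < n := Nat.cast_pos.2 hn0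
  -- The codebook size exceeds the critical `2 ^ (n (I + ε))` by the factor `2 ^ (n ε)`.
  set a : ℝ := (2 : ℝ) ^ (n * (I + 2 * ε)) with ha
  have ha1 : 1 ≤ a := Real.one_le_rpow (by norm_num) (by positivity)
  have hMa : a ≤ ⌈a⌉₊ := Nat.le_ceil a
  have hMa' : (⌈a⌉₊ : ℝ) ≤ 2 * a := by linarith [Nat.ceil_lt_add_one (zero_le_one.trans ha1)]
  have hMpos : 0 < ⌈a⌉₊ := Nat.ceil_pos.2 (zero_lt_one.trans_le ha1)
  obtain ⟨K, hK, hKd⟩ := exists_code_of_size hP hδ hWc n (I + ε) (add_nonneg hD hε0.le) hMpos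
  refine ⟨K, ?_, hKd.trans ?_⟩
  · have hloga : Real.logb 2 a = n * (I + 2 * ε) := Real.logb_rpow (by norm_num) (by norm_num)
    have h1 : Real.logb 2 a ≤ Real.logb 2 ⌈a⌉₊ :=
      Real.logb_le_logb_of_le (by norm_num) (by linarith) hMa
    have h2 : Real.logb 2 ⌈a⌉₊ ≤ Real.logb 2 (2 * a) :=
      Real.logb_le_logb_of_le (by norm_num) (by linarith) hMa'
    rw [Real.logb_mul (by norm_num) (by linarith), Real.logb_self_eq_one (by norm_num)] at h2
    rw [BlockCode.rate, hK, abs_le]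
    have h3 : I ≤ Real.logb 2 ⌈a⌉₊ / n := by
      rw [le_div_iff₀ hn0']
      nlinarith
    have h4 : Real.logb 2 ⌈a⌉₊ / n ≤ I + η := by
      rw [div_le_iff₀ hn0']
      have : η = 3 * ε := by rw [hε]; ring
      rw [this]
      linarith
    constructor <;> linarith
  · have h1 : ((2 : ℝ) ^ ε) ^ n ≤ (2 : ℝ) ^ (-(n * (I + ε))) * ⌈a⌉₊ := by
      calc ((2 : ℝ) ^ ε) ^ n = (2 : ℝ) ^ (-(n * (I + ε))) * a := by
            rw [ha, ← Real.rpow_add (by norm_num), ← Real.rpow_mul_natCast (by norm_num)]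
            congr 1
            ring
        _ ≤ _ := mul_le_mul_of_nonneg_left hMa (Real.rpow_nonneg (by norm_num) _)
    have h2 := Real.exp_le_exp.2 (neg_le_neg h1)
    have hΔ0 : 0 ≤ ∑ x, ∑ y, δ x y :=
      Finset.sum_nonneg fun x _ => Finset.sum_nonneg fun y _ => hδ x y
    have h3 := (mul_le_mul_of_nonneg_left (add_le_add_right h2 _) hΔ0).trans hn
    have h4 := mul_le_mul_of_nonneg_left h3 hn0'.le
    rw [← mul_assoc] at h4
    have : η = 3 * ε := by rw [hε]; ring
    rw [this]
    nlinarith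

/-- The direct part. At each block length a code is taken which is optimal, up to `1 / (n + 1)`,
for the larger of the two deviations from `I(P;W)` and `D`. -/
lemma achievable_mutualInfo {X Y : Type*} [Fintype X] [Fintype Y] {P : X → ℝ}
    (hP : P ∈ stdSimplex ℝ X) {δ : X → Y → ℝ} (hδ : ∀ x y, 0 ≤ δ x y) {D : ℝ} (hD : 0 ≤ D)
    {W : X → Y → ℝ} (hW : W ∈ feasibleChannels P δ D) :
    Achievable P δ (mutualInfo P W) D := by
  obtain ⟨x₀⟩ := nonempty_of_mem_stdSimplex hP
  obtain ⟨y₀⟩ := nonempty_of_mem_stdSimplex (hW.1 x₀)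
  let f : ∀ n, BlockCode X Y n → ℝ := fun n K =>
    max |K.rate - mutualInfo P W| (K.distortion P δ / n - D)
  have hf0 : ∀ n K, 0 ≤ f n K := fun n K => le_max_of_le_left (abs_nonneg _)
  have hex : ∀ n, ∃ K : BlockCode X Y n, ∀ K', f n K < f n K' + 1 / ((n : ℝ) + 1) := by
    intro n
    have : Nonempty (BlockCode X Y n) :=
      ⟨deterministicCode (M := 1) (fun _ => 0) (fun _ _ => y₀)⟩
    obtain ⟨K, hK⟩ := exists_lt_of_ciInf_lt
      (lt_add_of_pos_right (⨅ K, f n K) (Nat.one_div_pos_of_nat (α := ℝ) (n := n)))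
    exact ⟨K, fun K' => hK.trans_le (add_le_add_left
      (ciInf_le ⟨0, by rintro _ ⟨K, rfl⟩; exact hf0 n K⟩ K') _)⟩
  choose K hK using hex
  have hlim : ∀ ε > 0, ∀ᶠ n : ℕ in atTop, f n (K n) < ε := by
    intro ε hε
    have h1 := tendsto_one_div_add_atTop_nhds_zero_nat (𝕜 := ℝ)
    filter_upwards [eventually_exists_code hP hδ hD hW (half_pos hε),
      h1.eventually (gt_mem_nhds (half_pos hε)), eventually_gt_atTop 0] with n hn hn1 hn0
    obtain ⟨K', hr, hd⟩ := hn
    have hf : f n K' ≤ ε / 2 := by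
      refine max_le hr ?_
      rw [sub_le_iff_le_add, div_le_iff₀ (Nat.cast_pos.2 hn0)]
      linarith
    linarith [hK n K']
  refine ⟨mutualInfo_nonneg hP hW.1, hD, K, fun _ => trivial, ?_, fun ε hε => ?_⟩
  · rw [Metric.tendsto_nhds]
    intro ε hε
    filter_upwards [hlim ε hε] with n hn using (le_max_left _ _).trans_lt hn
  · filter_upwards [hlim ε hε, eventually_gt_atTop 0] with n hn hn0
    have h := (le_max_right _ _).trans hn.le
    rw [sub_le_iff_le_add, div_le_iff₀ (Nat.cast_pos.2 hn0)] at h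
    linarith

/-! ### The rate-distortion function -/

lemma rateDistortion_eq_of_isLeast {X Y : Type*} [Fintype X] [Fintype Y] {P : X → ℝ}
    {δ : X → Y → ℝ} {R D : ℝ} (h : IsLeast {R : ℝ | Achievable P δ R D} R) :
    rateDistortion P δ D = (R : EReal) :=
  (EReal.coe_strictMono.monotone.map_isLeast h).isGLB.sInf_eq

end RateDistortion

theorem mainTheorem8 {X Y : Type*} [Fintype X] [Fintype Y] (P : X → ℝ) (hP : P ∈ stdSimplex ℝ X)
    (δ : X → Y → ℝ) (hδ : ∀ x y, 0 ≤ δ x y) (D : ℝ) (hD : 0 ≤ D) :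
    -- the formula, where both sides are `⊤` if no channel satisfies the constraint
    RateDistortion.rateDistortion P δ D =
        sInf ((fun W => (RateDistortion.mutualInfo P W : EReal)) ''
          RateDistortion.feasibleChannels P δ D) ∧
      -- otherwise both infima are minima
      ((RateDistortion.feasibleChannels P δ D).Nonempty →
        ∃ W ∈ RateDistortion.feasibleChannels P δ D,
          (∀ V ∈ RateDistortion.feasibleChannels P δ D,
            RateDistortion.mutualInfo P W ≤ RateDistortion.mutualInfo P V) ∧
          RateDistortion.rateDistortion P δ D = (RateDistortion.mutualInfo P W : EReal) ∧
          IsLeast {R : ℝ | RateDistortion.Achievable P δ R D} (RateDistortion.mutualInfo P W)) ∧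
      -- the codes may be chosen to be deterministic
      (∀ R : ℝ, RateDistortion.Achievable P δ R D ↔ RateDistortion.AchievableDet P δ R D) := by
  have hmin : (RateDistortion.feasibleChannels P δ D).Nonempty →
      ∃ W ∈ RateDistortion.feasibleChannels P δ D,
        (∀ V ∈ RateDistortion.feasibleChannels P δ D,
          RateDistortion.mutualInfo P W ≤ RateDistortion.mutualInfo P V) ∧
        RateDistortion.rateDistortion P δ D = (RateDistortion.mutualInfo P W : EReal) ∧
        IsLeast {R : ℝ | RateDistortion.Achievable P δ R D} (RateDistortion.mutualInfo P W) := by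
    intro hne
    obtain ⟨W, hW, hWmin⟩ := RateDistortion.exists_feasible_minimizer P δ D hne
    have hleast : IsLeast {R : ℝ | RateDistortion.Achievable P δ R D}
        (RateDistortion.mutualInfo P W) := by
      refine ⟨RateDistortion.achievable_mutualInfo hP hδ hD hW, fun R hR => ?_⟩
      obtain ⟨V, hV, hVR⟩ := RateDistortion.Achievable.exists_feasible hP hR
      exact (hWmin V hV).trans hVR
    exact ⟨W, hW, hWmin, RateDistortion.rateDistortion_eq_of_isLeast hleast, hleast⟩
  refine ⟨?_, hmin, fun R => RateDistortion.achievable_iff_achievableDet hP δ R D⟩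
  rcases (RateDistortion.feasibleChannels P δ D).eq_empty_or_nonempty with hempty | hne
  · have hR : {R : ℝ | RateDistortion.Achievable P δ R D} = ∅ := by
      refine Set.eq_empty_of_forall_notMem fun R hR => ?_
      obtain ⟨V, hV, -⟩ := RateDistortion.Achievable.exists_feasible hP hR
      simp [hempty] at hV
    rw [RateDistortion.rateDistortion, hR, hempty, Set.image_empty, Set.image_empty]
  · obtain ⟨W, hW, hWmin, hrd, -⟩ := hmin hne
    rw [hrd]
    have hleast : IsLeast ((fun W => (RateDistortion.mutualInfo P W : EReal)) ''
        RateDistortion.feasibleChannels P δ D) (RateDistortion.mutualInfo P W) := by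
      refine ⟨⟨W, hW, rfl⟩, ?_⟩
      rintro _ ⟨V, hV, rfl⟩
      exact EReal.coe_le_coe_iff.2 (hWmin V hV)
    exact hleast.isGLB.sInf_eq.symm
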